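/- Let $\mathcal U,\mathcal B,\mathcal L,\mathcal V$ be pairwise disjoint, countably infinite sets (URIs, blank nodes, literals, variables) and let $\mathcal T=(\mathcal U\cup\mathcal B)\times\mathcal U\times(\mathcal U\cup\mathcal B\cup\mathcal L)$ be the set of RDF triples. **Webs.** A *Web of Linked Data* is a tuple $W=(D,\mathit{data},\mathit{adoc})$ where $D$ is a finite or countably infinite set (of documents), $\mathit{data}$ assigns to each $d\in D$ a finite subset of $\mathcal T$ such that the data of distinct documents have no blank node in common, and $\mathit{adoc}:\mathcal U\rightharpoonup D$ is a partial surjective mapping. $W$ is finite if $D$ is finite. For $D'\subseteq D$ the induced subweb on $D'$ has documents $D'$, the data of $W$, and $\mathit{adoc}$ restricted to the URIs that $\mathit{adoc}$ maps into $D'$. **SPARQL.** SPARQL expressions are built from triple patterns in $(\mathcal V\cup\mathcal U)\times(\mathcal V\cup\mathcal U)\times(\mathcal V\cup\mathcal U\cup\mathcal L)$ by AND, UNION, OPT and FILTER (filter conditions: Boolean combinations of $?x=c$, $?x={?y}$, $\mathrm{bound}(?x)$, with $c\in\mathcal U\cup\mathcal L$). For a possibly infinite set $G$ of triples, $[\![P]\!]_G$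 is the usual set of valuations (partial maps $\mathcal V\rightharpoonup\mathcal U\cup\mathcal B\cup\mathcal L$): for a triple pattern, the valuations whose domain is its set of variables and that turn it into an element of $G$; AND, UNION, OPT and FILTER are join of compatible valuations, union, left outer join and selection. Let $\mathcal P$ be the set of SPARQL expressions. **Reachability.** A *reachability criterion* is a computable total function $c:\mathcal T\times\mathcal U\times\mathcal P\to\{\mathrm{true},\mathrm{false}\}$; $c_{\mathsf{None}}$ is constantly false. A criterion $c$ is *less restrictive* than $c'$ if $c$ is true wherever $c'$ is, and $c$ is true at some argument where $c'$ is false. For a finite $S\subset\mathcal U$, the set of documents that are $(c,P)$-reachable from $S$ in $W$ is the smallest set that contains $\mathit{adoc}(u)$ for each $u\in S\cap\mathrm{dom}(\mathit{adoc})$ and that contains $\mathit{adoc}(u)$ whenever it contains a document $d'$ such that $u\in\mathrm{dom}(\mathit{adoc})$ occurs in some $t\in\mathit{data}(d')$ with $c(t,u,P)=\mathrm{true}$. The *$(S,c,P)$-reachable part* of $W$ is the subweb $W'$ induced by these documents, and the result over $W$ of the *SPARQL$_{\mathsf{LD}(R)}$ query* given by $P,S,c$ is $[\![P]\!]_{G}$,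 where $G$ is the set of all triples in the data of documents of $W'$. **Machines.** An *LD machine* is a deterministic multi-tape Turing machine with finitely many states and five tapes: a read-only input tape, a read-only Web tape, a two-way infinite work tape, a right-infinite link traversal tape (a work tape as well), and an append-only output tape. The Web tape holds the possibly infinite word $\sharp\,\mathrm{enc}(u_1)\,\mathrm{enc}(\mathit{adoc}(u_1))\,\sharp\,\mathrm{enc}(u_2)\,\mathrm{enc}(\mathit{adoc}(u_2))\,\sharp\cdots$, where $u_1,u_2,\dots$ lists $\mathrm{dom}(\mathit{adoc})$, URIs are encoded in binary and a document is encoded by the bracketed list of its triples. The Web tape is accessed only in a special state *expand*: if the maximal binary suffix of the word on the link traversal tape is $\mathrm{enc}(u)$ for some URI $u$ and the Web tape contains $\sharp\,\mathrm{enc}(u)\,\mathrm{enc}(\mathit{adoc}(u))\,\sharp$, then $\mathrm{enc}(\mathit{adoc}(u))\,\sharp$ is appended to that word, otherwise $\sharp$ is appended; after that the machine proceeds by its transition function. A problem $DP\subseteq\mathcal W'\times\mathcal X$ ($\mathcal W'$ a set of Webs, $\mathcal X$ a set of finite structures) is *LD machine decidable* if there is an LD machine that, for all $W\in\mathcal W'$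 on the Web tape and all $X\in\mathcal X$ encoded on the input tape, halts in an accepting state if $(W,X)\in DP$ and halts in a rejecting state otherwise. **Theorem.** Consider the following two decision problems. Both have as input an arbitrary (possibly infinite) Web of Linked Data $W$ on the Web tape and, on the input tape, a finite nonempty set $S\subset\mathcal U$, a reachability criterion $c$ that is less restrictive than $c_{\mathsf{None}}$, and a SPARQL expression $P$. 1. *FinitenessReachablePart*: is the $(S,c,P)$-reachable part of $W$ finite? 2. *Finiteness(SPARQL$_{\mathsf{LD}(R)}$)*: is the result over $W$ of the SPARQL$_{\mathsf{LD}(R)}$ query given by $P,S,c$ finite? Neither problem is LD machine decidable, whatever (injective) encoding of reachability criteria by binary words is used on the input tape. -/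

import Mathlib

namespace LinkedData

/-! ### RDF terms, triples -/

/-- URIs; the countably infinite set of URIs is indexed by the natural numbers. -/
@[ext] structure URI where
  id : ℕ
deriving DecidableEq

/-- Blank nodes. -/
@[ext] structure BNode where
  id : ℕ
deriving DecidableEq

/-- Literals. -/
@[ext] structure Literal where
  id : ℕ
deriving DecidableEq

/-- Query variables. -/
@[ext] structure Var where
  id : ℕ
deriving DecidableEq

/-- RDF terms: the disjoint union of URIs, blank nodes and literals. -/
inductive Term where
  | uri (u : URI)
  | bnode (b : BNode)
  | lit (l : Literal)
deriving DecidableEq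

/-- RDF triples: elements of (URIs ∪ blank nodes) × URIs × (URIs ∪ blank nodes ∪ literals). -/
@[ext] structure Triple where
  s : URI ⊕ BNode
  p : URI
  o : Term
deriving DecidableEq

namespace Triple

/-- The subject of a triple, as an RDF term. -/
def subject (t : Triple) : Term := t.s.elim Term.uri Term.bnode

/-- The terms of a triple. -/
def terms (t : Triple) : Set Term := {t.subject, Term.uri t.p, t.o}

/-- The URIs that occur in a triple. -/
def uris (t : Triple) : Set URI := {u | Term.uri u ∈ t.terms}

/-- The blank nodes that occur in a triple. -/
def bnodes (t : Triple) : Set BNode := {b | Term.bnode b ∈ t.terms}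

end Triple

/-! ### SPARQL expressions and their evaluation -/

/-- Triple patterns: (variables ∪ URIs) × (variables ∪ URIs) × (variables ∪ URIs ∪ literals). -/
structure TriplePattern where
  s : Var ⊕ URI
  p : Var ⊕ URI
  o : Var ⊕ (URI ⊕ Literal)

/-- Filter conditions. -/
inductive FilterCond where
  | eqConst (x : Var) (c : URI ⊕ Literal)
  | eqVar (x y : Var)
  | bound (x : Var)
  | neg (R : FilterCond)
  | conj (R₁ R₂ : FilterCond)
  | disj (R₁ R₂ : FilterCond)

/-- SPARQL expressions. -/
inductive Expr where
  | tp (t : TriplePattern)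
  | and (P₁ P₂ : Expr)
  | union (P₁ P₂ : Expr)
  | opt (P₁ P₂ : Expr)
  | filter (P : Expr) (R : FilterCond)

/-- Valuations: partial mappings from variables to RDF terms. -/
abbrev Valuation := Var → Option Term

/-- The domain of a valuation. -/
def Valuation.dom (μ : Valuation) : Set Var := {v | (μ v).isSome}

/-- A constant of a triple pattern or filter condition, as an RDF term. -/
def constTerm : URI ⊕ Literal → Term := Sum.elim Term.uri Term.lit

namespace TriplePattern

/-- The variables of a triple pattern. -/
def vars (tp : TriplePattern) : Set Var :=
  {v | tp.s = Sum.inl v ∨ tp.p = Sum.inl v ∨ tp.o = Sum.inl v}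

/-- `tp.Instance μ t`: replacing the variables of `tp` according to `μ` gives the triple `t`. -/
def Instance (tp : TriplePattern) (μ : Valuation) (t : Triple) : Prop :=
  tp.s.elim μ (fun u => some (Term.uri u)) = some t.subject ∧
  tp.p.elim μ (fun u => some (Term.uri u)) = some (Term.uri t.p) ∧
  tp.o.elim μ (fun c => some (constTerm c)) = some t.o

end TriplePattern

/-- `R.Sat μ`: the valuation `μ` satisfies the filter condition `R`. -/
def FilterCond.Sat (μ : Valuation) : FilterCond → Prop
  | eqConst x c => μ x = some (constTerm c)
  | eqVar x y => ∃ a, μ x = some a ∧ μ y = some a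
  | bound x => x ∈ μ.dom
  | neg R => ¬ R.Sat μ
  | conj R₁ R₂ => R₁.Sat μ ∧ R₂.Sat μ
  | disj R₁ R₂ => R₁.Sat μ ∨ R₂.Sat μ

/-- Two valuations are compatible if they agree on every variable that both of them bind. -/
def Valuation.Compatible (μ ν : Valuation) : Prop :=
  ∀ v a b, μ v = some a → ν v = some b → a = b

/-- The union of two (compatible) valuations. -/
def Valuation.merge (μ ν : Valuation) : Valuation := fun v => (μ v).or (ν v)

/-- Join of two sets of valuations. -/
def join (A B : Set Valuation) : Set Valuation :=
  {κ | ∃ μ ∈ A, ∃ ν ∈ B, μ.Compatible ν ∧ κ = μ.merge ν}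

/-- Difference of two sets of valuations. -/
def diff (A B : Set Valuation) : Set Valuation :=
  {μ | μ ∈ A ∧ ∀ ν ∈ B, ¬ μ.Compatible ν}

/-- The evaluation of a SPARQL expression over a (possibly infinite) set of triples. -/
def Expr.eval (G : Set Triple) : Expr → Set Valuation
  | tp t => {μ | μ.dom = t.vars ∧ ∃ x ∈ G, t.Instance μ x}
  | and P₁ P₂ => join (P₁.eval G) (P₂.eval G)
  | union P₁ P₂ => P₁.eval G ∪ P₂.eval G
  | opt P₁ P₂ => join (P₁.eval G) (P₂.eval G) ∪ diff (P₁.eval G) (P₂.eval G)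
  | filter P R => {μ | μ ∈ P.eval G ∧ R.Sat μ}

/-! ### Webs of Linked Data -/

/-- A Web of Linked Data `(D, data, adoc)`. -/
structure Web where
  /-- the LD documents -/
  D : Type
  countable_D : Countable D
  /-- the finite set of triples of a document -/
  data : D → Finset Triple
  /-- distinct documents use no common blank node -/
  bnodes_disjoint : ∀ d₁ d₂, d₁ ≠ d₂ →
    ∀ t₁ ∈ data d₁, ∀ t₂ ∈ data d₂, Disjoint t₁.bnodes t₂.bnodes
  /-- the partial mapping from URIs to authoritative documents -/
  adoc : URI → Option D
  adoc_surjective : ∀ d, ∃ u, adoc u = some d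

namespace Web

/-- A Web of Linked Data is finite if it has finitely many documents. -/
def IsFinite (W : Web) : Prop := Finite W.D

/-- All triples in a Web of Linked Data. -/
def allData (W : Web) : Set Triple := {t | ∃ d, t ∈ W.data d}

/-- The induced subweb whose documents are those in `D'`. -/
noncomputable def induced (W : Web) (D' : Set W.D) : Web where
  D := D'
  countable_D := by
    have := W.countable_D
    infer_instance
  data d := W.data d.1
  bnodes_disjoint d₁ d₂ h := W.bnodes_disjoint d₁.1 d₂.1 (fun e => h (Subtype.ext e))
  adoc u := (W.adoc u).bind fun d =>
    open Classical in if h : d ∈ D' then some ⟨d, h⟩ else none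
  adoc_surjective d := by
    obtain ⟨u, hu⟩ := W.adoc_surjective d.1
    exact ⟨u, by simp [hu]⟩

end Web

/-! ### Encodings as words -/

/-- The symbols used in encodings. -/
inductive Sym where
  | bit (b : Bool)
  /-- the separator `♯` -/
  | hash
  /-- the brackets of triples and triple patterns -/
  | lang | rang
  /-- the brackets of finite sets -/
  | llang | rrang
  | comma | lpar | rpar
  | and | union | opt | filter
  | eq | bound | neg | conj | disj
deriving DecidableEq, Fintype

noncomputable instance : Primcodable Sym :=
  Primcodable.ofEquiv (Fin (Fintype.card Sym)) (Fintype.equivFin Sym)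

/-- The word over the encoding alphabet given by a binary word. -/
def bits (w : List Bool) : List Sym := w.map Sym.bit

/-- Binary representation of a URI: a two-bit mark of the kind of symbol, then the index
in binary. The marks keep the representations of URIs, blank nodes, literals and variables
apart. -/
def URI.bin (u : URI) : List Bool := false :: false :: Nat.bits u.id

def BNode.bin (b : BNode) : List Bool := false :: true :: Nat.bits b.id

def Literal.bin (l : Literal) : List Bool := true :: false :: Nat.bits l.id

def Var.bin (v : Var) : List Bool := true :: true :: Nat.bits v.id

def Term.bin : Term → List Bool
  | uri u => u.bin
  | bnode b => b.bin
  | lit l => l.bin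

/-- `⟨ a , b , c ⟩` -/
def encTuple (a b c : List Bool) : List Sym :=
  Sym.lang :: bits a ++ Sym.comma :: bits b ++ Sym.comma :: bits c ++ [Sym.rang]

/-- `⟨⟨ w₁ , … , wₙ ⟩⟩` -/
def encList (ws : List (List Sym)) : List Sym :=
  Sym.llang :: List.intercalate [Sym.comma] ws ++ [Sym.rrang]

def encTriple (t : Triple) : List Sym := encTuple t.subject.bin t.p.bin t.o.bin

/-- Kind and index of a term; they determine the order of terms. -/
def Term.key : Term → ℕ × ℕ
  | uri u => (0, u.id)
  | bnode b => (1, b.id)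
  | lit l => (2, l.id)

/-- The order of triples is the lexicographic order of these keys. -/
def Triple.key (t : Triple) : List ℕ :=
  [t.subject.key.1, t.subject.key.2, t.p.id, t.o.key.1, t.o.key.2]

theorem Term.key_injective : Function.Injective Term.key := by
  rintro (⟨⟨a⟩⟩ | ⟨⟨a⟩⟩ | ⟨⟨a⟩⟩) (⟨⟨b⟩⟩ | ⟨⟨b⟩⟩ | ⟨⟨b⟩⟩) h <;> simp_all [Term.key]

theorem Triple.key_injective : Function.Injective Triple.key := by
  rintro ⟨s, p, o⟩ ⟨s', p', o'⟩ h
  simp only [Triple.key, List.cons.injEq, and_true] at h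
  obtain ⟨h1, h2, h3, h4, h5⟩ := h
  have hs := Term.key_injective (Prod.ext h1 h2)
  have ho := Term.key_injective (Prod.ext h4 h5)
  have hp : p = p' := URI.ext h3
  subst hp
  subst ho
  rcases s with s | s <;> rcases s' with s' | s' <;> simp_all [Triple.subject]

noncomputable instance : LinearOrder Triple := LinearOrder.lift' Triple.key Triple.key_injective

instance : LinearOrder URI :=
  LinearOrder.lift' URI.id (fun _ _ h => URI.ext h)

/-- The encoding of a finite set of triples: the encodings of its elements in ascending order. -/
noncomputable def encTriples (T : Finset Triple) : List Sym :=
  encList ((T.sort (· ≤ ·)).map encTriple)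

/-- The encoding of a finite set of URIs, in ascending order. -/
def encURIs (S : Finset URI) : List Sym :=
  encList ((S.sort (· ≤ ·)).map fun u => bits u.bin)

def encPattern (t : TriplePattern) : List Sym :=
  encTuple (t.s.elim Var.bin URI.bin) (t.p.elim Var.bin URI.bin)
    (t.o.elim Var.bin (Sum.elim URI.bin Literal.bin))

def FilterCond.enc : FilterCond → List Sym
  | eqConst x c =>
      Sym.lpar :: bits x.bin ++ Sym.eq :: bits (c.elim URI.bin Literal.bin) ++ [Sym.rpar]
  | eqVar x y => Sym.lpar :: bits x.bin ++ Sym.eq :: bits y.bin ++ [Sym.rpar]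
  | bound x => Sym.lpar :: Sym.bound :: bits x.bin ++ [Sym.rpar]
  | neg R => Sym.lpar :: Sym.neg :: R.enc ++ [Sym.rpar]
  | conj R₁ R₂ => Sym.lpar :: R₁.enc ++ Sym.conj :: R₂.enc ++ [Sym.rpar]
  | disj R₁ R₂ => Sym.lpar :: R₁.enc ++ Sym.disj :: R₂.enc ++ [Sym.rpar]

def Expr.enc : Expr → List Sym
  | tp t => encPattern t
  | and P₁ P₂ => Sym.lpar :: P₁.enc ++ Sym.and :: P₂.enc ++ [Sym.rpar]
  | union P₁ P₂ => Sym.lpar :: P₁.enc ++ Sym.union :: P₂.enc ++ [Sym.rpar]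
  | opt P₁ P₂ => Sym.lpar :: P₁.enc ++ Sym.opt :: P₂.enc ++ [Sym.rpar]
  | filter P R => Sym.lpar :: P.enc ++ Sym.filter :: R.enc ++ [Sym.rpar]

namespace Web

/-- The encoding of an LD document is the encoding of its data. -/
noncomputable def encDoc (W : Web) (d : W.D) : List Sym := encTriples (W.data d)

/-- The part `♯ enc(u₁) enc(adoc(u₁)) ♯ … ♯ enc(uₖ) enc(adoc(uₖ)) ♯` of the encoding of `W`
for the URIs `u₁, …, uₖ` in the domain of `adoc` that have index less than `N`,
in ascending order. -/
noncomputable def tapePrefix (W : Web) (N : ℕ) : List Sym :=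
  Sym.hash :: (List.range N).flatMap fun n =>
    match W.adoc ⟨n⟩ with
    | none => []
    | some d => bits (URI.bin ⟨n⟩) ++ W.encDoc d ++ [Sym.hash]

/-- The possibly infinite word `♯ enc(u₁) enc(adoc(u₁)) ♯ enc(u₂) enc(adoc(u₂)) ♯ …` that
encodes `W`, as the content of a right-infinite tape: the limit of the words
`W.tapePrefix N`, each of which is a prefix of the next; `none` is the blank. -/
noncomputable def tape (W : Web) (i : ℕ) : Option Sym :=
  open Classical in
  if h : ∃ N, i < (W.tapePrefix N).length then (W.tapePrefix h.choose)[i]? else none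

end Web

/-- The word `w` occurs on the tape `τ`. -/
def Occurs (w : List Sym) (τ : ℕ → Option Sym) : Prop :=
  ∃ k, ∀ i, i < w.length → τ (k + i) = w[i]?

theorem Web.tapePrefix_prefix (W : Web) {M N : ℕ} (h : M ≤ N) :
    W.tapePrefix M <+: W.tapePrefix N := by
  obtain ⟨k, rfl⟩ := Nat.exists_eq_add_of_le h
  unfold Web.tapePrefix
  rw [List.range_add, List.flatMap_append]
  exact ⟨_, rfl⟩

theorem Web.tape_eq (W : Web) {N i : ℕ} (h : i < (W.tapePrefix N).length) :
    W.tape i = (W.tapePrefix N)[i]? := by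
  have hex : ∃ N, i < (W.tapePrefix N).length := ⟨N, h⟩
  have hc := hex.choose_spec
  unfold Web.tape
  rw [dif_pos hex]
  rcases le_total hex.choose N with hle | hle
  · obtain ⟨r, hr⟩ := W.tapePrefix_prefix hle
    rw [← hr, List.getElem?_append_left hc]
  · obtain ⟨r, hr⟩ := W.tapePrefix_prefix hle
    rw [← hr, List.getElem?_append_left h]

/-- The tape of `W` contains `♯ enc(u) enc(adoc(u)) ♯` for each `u` in the domain of `adoc`. -/
theorem Web.occurs_tape (W : Web) {u : URI} {d : W.D} (h : W.adoc u = some d) :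
    Occurs (Sym.hash :: bits u.bin ++ W.encDoc d ++ [Sym.hash]) W.tape := by
  have key : ∃ a b, W.tapePrefix (u.id + 1) =
      a ++ (Sym.hash :: bits u.bin ++ W.encDoc d ++ [Sym.hash]) ++ b := by
    have hlast : ∀ n, ∃ a, W.tapePrefix n = a ++ [Sym.hash] := by
      intro n
      induction n with
      | zero => exact ⟨[], rfl⟩
      | succ n ih =>
        obtain ⟨a, ha⟩ := ih
        have hs : W.tapePrefix (n + 1) = W.tapePrefix n ++ (match W.adoc ⟨n⟩ with
            | none => []
            | some d => bits (URI.bin ⟨n⟩) ++ W.encDoc d ++ [Sym.hash]) := by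
          simp [Web.tapePrefix, List.range_succ, List.flatMap_append]
        rw [hs]
        cases hd : W.adoc ⟨n⟩ with
        | none => exact ⟨a, by simp [ha]⟩
        | some d => exact ⟨W.tapePrefix n ++ bits (URI.bin ⟨n⟩) ++ W.encDoc d, by simp⟩
    obtain ⟨a, ha⟩ := hlast u.id
    refine ⟨a, [], ?_⟩
    have hs : W.tapePrefix (u.id + 1) = W.tapePrefix u.id ++ (match W.adoc ⟨u.id⟩ with
        | none => []
        | some d => bits (URI.bin ⟨u.id⟩) ++ W.encDoc d ++ [Sym.hash]) := by
      simp [Web.tapePrefix, List.range_succ, List.flatMap_append]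
    have hu : (⟨u.id⟩ : URI) = u := rfl
    rw [hs, ha, hu, h]
    simp
  obtain ⟨a, b, hab⟩ := key
  refine ⟨a.length, fun i hi => ?_⟩
  rw [W.tape_eq (N := u.id + 1) (by rw [hab]; simp only [List.length_append] at hi ⊢; omega), hab,
    List.append_assoc, List.getElem?_append_right (by omega),
    List.getElem?_append_left (by simpa using hi)]
  simp

/-- The URI with the given binary representation, if there is one. -/
noncomputable def decodeURI (w : List Bool) : Option URI :=
  open Classical in if h : ∃ u : URI, u.bin = w then some h.choose else none

theorem URI.bin_injective : Function.Injective URI.bin := by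
  rintro ⟨a⟩ ⟨b⟩ h
  have h' : Nat.bits a = Nat.bits b := by simpa [URI.bin] using h
  have hd : ∀ n, Nat.digits 2 n = (Nat.bits n).map fun b => cond b 1 0 :=
    fun n => Nat.digits_two_eq_bits n
  have : Nat.digits 2 a = Nat.digits 2 b := by rw [hd, hd, h']
  rw [Nat.digits_inj_iff.mp this]

theorem decodeURI_eq_some_iff {w : List Bool} {u : URI} :
    decodeURI w = some u ↔ u.bin = w := by
  unfold decodeURI
  constructor
  · intro h
    split_ifs at h with hex
    rw [← Option.some.inj h]
    exact hex.choose_spec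
  · intro h
    have hex : ∃ u : URI, u.bin = w := ⟨u, h⟩
    rw [dif_pos hex, URI.bin_injective (hex.choose_spec.trans h.symm)]

/-! ### LD machines -/

/-- Head movements. -/
inductive Move where
  | left | stay | right

/-- A two-way infinite tape with a head: `left` is the part to the left of the head, read
from the head outwards, and `right` starts with the scanned cell. All further cells are
blank (`none`). -/
structure TwoWayTape (α : Type) where
  left : List (Option α)
  right : List (Option α)

namespace TwoWayTape

variable {α : Type}

def read (t : TwoWayTape α) : Option α := t.right.headD none

def write (t : TwoWayTape α) (a : Option α) : TwoWayTape α := ⟨t.left, a :: t.right.tail⟩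

def move (t : TwoWayTape α) : Move → TwoWayTape α
  | Move.left => ⟨t.left.tail, t.left.headD none :: t.right⟩
  | Move.stay => t
  | Move.right => ⟨t.right.headD none :: t.left, t.right.tail⟩

end TwoWayTape

/-- A right-infinite tape with a head: the cells beyond the list `cells` are blank. -/
structure RightTape (α : Type) where
  cells : List (Option α)
  pos : ℕ

namespace RightTape

variable {α : Type}

def read (t : RightTape α) : Option α := t.cells.getD t.pos none

def write (t : RightTape α) (a : Option α) : RightTape α :=
  ⟨(t.cells ++ List.replicate (t.pos + 1 - t.cells.length) none).set t.pos a, t.pos⟩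

/-- A move to the left on the leftmost cell leaves the head where it is. -/
def move (t : RightTape α) : Move → RightTape α
  | Move.left => ⟨t.cells, t.pos - 1⟩
  | Move.stay => t
  | Move.right => ⟨t.cells, t.pos + 1⟩

/-- The word on the tape: everything up to the last nonblank cell. -/
def word (t : RightTape α) : List (Option α) := t.cells.rdropWhile Option.isNone

/-- Append a word to the right end of the word on the tape. -/
def append (t : RightTape α) (w : List α) : RightTape α := ⟨t.word ++ w.map some, t.pos⟩

end RightTape

/-- One ordinary step: next state, symbols written on the work tape and on the link traversal
tape, movements of the three heads, and possibly a symbol appended to the output tape. -/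
structure Action (State Γ : Type) where
  state : State
  workWrite : Option Γ
  linkWrite : Option Γ
  inputMove : Move
  workMove : Move
  linkMove : Move
  output : Option Γ

/-- An LD machine. Its tape alphabet consists of the symbols used in encodings and of finitely
many further symbols; the blank is `none`. The transition function depends on the state and on
the symbols scanned on the input tape, the work tape and the link traversal tape; the value
`none` means that the machine halts. -/
structure LDMachine where
  State : Type
  finite_State : Finite State
  /-- further tape symbols -/
  Aux : Type
  finite_Aux : Finite Aux
  start : State
  expand : State
  accepting : Set State
  rejecting : Set State
  disjoint : Disjoint accepting rejecting
  δ : State → Option Sym → Option (Sym ⊕ Aux) → Option (Sym ⊕ Aux) →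
    Option (Action State (Sym ⊕ Aux))

namespace LDMachine

/-- The digit in a tape cell, if the cell contains a binary digit. -/
def digit {A : Type} : Option (Sym ⊕ A) → Option Bool
  | some (Sum.inl (Sym.bit b)) => some b
  | _ => none

/-- The longest suffix of a word that consists of binary digits. -/
def binarySuffix {A : Type} (w : List (Option (Sym ⊕ A))) : List Bool :=
  (w.rtakeWhile fun c => (digit c).isSome).filterMap digit

/-- The word that the expand procedure appends to the word `w` on the link traversal tape. -/
noncomputable def answer {A : Type} (W : Web) (w : List (Option (Sym ⊕ A))) : List Sym :=
  match decodeURI (binarySuffix w) with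
  | none => [Sym.hash]
  | some u =>
    match W.adoc u with
    | none => [Sym.hash]
    | some d =>
      open Classical in
      if Occurs (Sym.hash :: bits u.bin ++ W.encDoc d ++ [Sym.hash]) W.tape then
        W.encDoc d ++ [Sym.hash]
      else [Sym.hash]

/-- Configurations. The read-only Web tape is not part of them. -/
structure Config (M : LDMachine) where
  state : M.State
  input : TwoWayTape Sym
  work : TwoWayTape (Sym ⊕ M.Aux)
  link : RightTape (Sym ⊕ M.Aux)
  output : List (Sym ⊕ M.Aux)

variable (M : LDMachine)

/-- The initial configuration with the word `x` on the ordinary input tape. -/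
def init (x : List Sym) : M.Config :=
  ⟨M.start, ⟨[], x.map some⟩, ⟨[], []⟩, ⟨[], 0⟩, []⟩

/-- The expand procedure. -/
noncomputable def doExpand (W : Web) (c : M.Config) : M.Config :=
  { c with link := c.link.append ((answer W c.link.word).map Sum.inl) }

/-- An ordinary step of a multi-tape Turing machine. -/
def ordinaryStep (c : M.Config) : Option M.Config :=
  (M.δ c.state c.input.read c.work.read c.link.read).map fun a =>
    { state := a.state
      input := c.input.move a.inputMove
      work := (c.work.write a.workWrite).move a.workMove
      link := (c.link.write a.linkWrite).move a.linkMove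
      output := c.output ++ a.output.toList }

/-- One step with `W` on the Web tape: in the state `expand` the expand procedure is performed
first, and the machine then goes on as in any other state. -/
noncomputable def step (W : Web) (c : M.Config) : Option M.Config :=
  open Classical in
  M.ordinaryStep (if c.state = M.expand then M.doExpand W c else c)

/-- The configuration after `n` steps, if the machine has not halted before. -/
noncomputable def run (W : Web) (x : List Sym) : ℕ → Option M.Config
  | 0 => some (M.init x)
  | n + 1 => (run W x n).bind (M.step W)

/-- With `W` on the Web tape and `x` on the ordinary input tape, the machine halts after
finitely many steps, in a state that belongs to `A`. -/
def HaltsIn (W : Web) (x : List Sym) (A : Set M.State) : Prop :=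
  ∃ n c, M.run W x n = some c ∧ M.step W c = none ∧ c.state ∈ A

end LDMachine

/-- LD machine decidability of the decision problem for `DP ⊆ 𝒲 × 𝒳`, where `enc` is the
encoding of further input. -/
def LDMachineDecidable {X : Type} (enc : X → List Sym) (𝒲 : Set Web) (𝒳 : Set X)
    (DP : Set (Web × X)) : Prop :=
  ∃ M : LDMachine, ∀ W ∈ 𝒲, ∀ x ∈ 𝒳,
    ((W, x) ∈ DP → M.HaltsIn W (enc x) M.accepting) ∧
    ((W, x) ∉ DP → M.HaltsIn W (enc x) M.rejecting)

/-! ### Reachability-based semantics -/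

/-- Reachability criteria: computable total functions from triples × URIs × SPARQL expressions
to truth values. Computability is that of a (partial) function on words which gives the value
on the encoding of each argument. -/
structure ReachCriterion where
  toFun : Triple → URI → Expr → Bool
  computable : ∃ f : List Sym →. Bool, Partrec f ∧ ∀ t u P,
    toFun t u P ∈ f (encTriple t ++ Sym.hash :: bits u.bin ++ Sym.hash :: P.enc)

/-- The criterion that accepts no data link at all. -/
def cNone : ReachCriterion where
  toFun _ _ _ := false
  computable := ⟨fun _ => Part.some false, (Computable.const false).partrec, fun _ _ _ =>
    Part.mem_some false⟩

/-- `c.LessRestrictive c'`: `c` accepts whatever `c'` accepts, and accepts something that `c'`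
does not accept. -/
def ReachCriterion.LessRestrictive (c c' : ReachCriterion) : Prop :=
  (∀ t u P, c'.toFun t u P = true → c.toFun t u P = true) ∧
  ∃ t u P, c.toFun t u P = true ∧ c'.toFun t u P = false

/-- `Reachable W S c P d`: the document `d` is `(c, P)`-reachable from `S` in `W`. -/
inductive Reachable (W : Web) (S : Finset URI) (c : ReachCriterion) (P : Expr) : W.D → Prop
  | seed {u : URI} {d : W.D} : u ∈ S → W.adoc u = some d → Reachable W S c P d
  | link {d' d : W.D} {t : Triple} {u : URI} : Reachable W S c P d' → t ∈ W.data d' →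
      u ∈ t.uris → c.toFun t u P = true → W.adoc u = some d → Reachable W S c P d

/-- The `(S, c, P)`-reachable part of `W`: the induced subweb of the reachable documents. -/
noncomputable def reachablePart (W : Web) (S : Finset URI) (c : ReachCriterion) (P : Expr) :
    Web :=
  W.induced {d | Reachable W S c P d}

/-- The result over `W` of the query under reachability-based semantics that uses the
expression `P`, the seeds `S` and the criterion `c`. -/
noncomputable def reachQuery (P : Expr) (S : Finset URI) (c : ReachCriterion) (W : Web) :
    Set Valuation :=
  P.eval (reachablePart W S c P).allData

/-! ### The two decision problems -/

/-- The ordinary input of both problems: seed URIs, a reachability criterion and a SPARQL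
expression. -/
structure ReachInput where
  seeds : Finset URI
  crit : ReachCriterion
  expr : Expr

/-- The encoding of the ordinary input, given an encoding of reachability criteria. -/
def ReachInput.enc (encC : ReachCriterion → List Bool) (X : ReachInput) : List Sym :=
  encURIs X.seeds ++ Sym.hash :: bits (encC X.crit) ++ Sym.hash :: X.expr.enc

/-- The admissible inputs: nonempty finite sets of seeds, and criteria that are less
restrictive than `cNone`. -/
def admissibleInputs : Set ReachInput :=
  {X | X.seeds.Nonempty ∧ X.crit.LessRestrictive cNone}

/-- Is the `(S, c, P)`-reachable part of `W` finite? -/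
def FinitenessReachablePart : Set (Web × ReachInput) :=
  {I | (reachablePart I.1 I.2.seeds I.2.crit I.2.expr).IsFinite}

/-- Is the result of the query over `W` finite? -/
def FinitenessQueryResult : Set (Web × ReachInput) :=
  {I | (reachQuery I.2.expr I.2.seeds I.2.crit I.1).Finite}

end LinkedData

/-! The argument is one of finite information. A halting run makes finitely many steps, and each
step learns from the Web at most the data behind one URI. Hence the run is unchanged on any Web with
the same data behind the URIs of index below some N (`HaltsIn.exists_congr`). Take the infinite
chain in which document n names the URI of document n + 1, with seed 0, all links accepted, and a
pattern of three distinct variables. Every document is reachable and each contributes its own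
solution, so both problems have the answer no and a decider must reject after finitely many lookups.
Cutting the chain at N leaves those lookups unchanged but makes the Web finite, so both answers
become yes. The same input word is then both accepted and rejected on the truncated Web, which
determinism forbids (`not_ldMachineDecidable_of_approx`). -/

namespace LinkedData

/-! ### Halting computations and finitely many lookups -/

namespace Web

/-- The data found by looking up a URI. -/
def lookup (W : Web) (u : URI) : Option (Finset Triple) := (W.adoc u).map W.data

end Web

namespace LDMachine

/-- By `occurs_tape` the search on the Web tape never fails for a URI in the domain of `adoc`, so
the tape drops out. What remains is a finite set of triples, which can be compared between Webs
whose document types differ. -/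
theorem answer_eq {A : Type} (W : Web) (w : List (Option (Sym ⊕ A))) :
    answer W w = match decodeURI (binarySuffix w) with
      | none => [Sym.hash]
      | some u => match W.lookup u with
        | none => [Sym.hash]
        | some T => encTriples T ++ [Sym.hash] := by
  unfold answer Web.lookup
  cases decodeURI (binarySuffix w) with
  | none => rfl
  | some u =>
    dsimp only
    cases h : W.adoc u with
    | none => rfl
    | some d =>
      dsimp only [Option.map_some]
      rw [if_pos (W.occurs_tape h)]
      rfl

/-- The answer to a lookup depends on the lookup of at most one URI. -/
theorem exists_answer_congr {A : Type} (W : Web) (w : List (Option (Sym ⊕ A))) :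
    ∃ N, ∀ W' : Web, (∀ u : URI, u.id < N → W'.lookup u = W.lookup u) →
      answer W' w = answer W w := by
  cases h : decodeURI (binarySuffix w) with
  | none => exact ⟨0, fun W' _ => by rw [answer_eq, answer_eq, h]⟩
  | some u =>
    -- The least bound that covers the one URI looked up.
    refine ⟨u.id + 1, fun W' hW' => ?_⟩
    rw [answer_eq, answer_eq, h]
    dsimp only
    rw [hW' u (Nat.lt_succ_self _)]

variable (M : LDMachine)

/-- The transition function does not see the Web; the Web enters only through the answer appended in
the state `expand`. -/
theorem exists_step_congr (W : Web) (c : M.Config) :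
    ∃ N, ∀ W' : Web, (∀ u : URI, u.id < N → W'.lookup u = W.lookup u) →
      M.step W' c = M.step W c := by
  obtain ⟨N, hN⟩ := exists_answer_congr W c.link.word
  refine ⟨N, fun W' hW' => ?_⟩
  unfold step doExpand
  rw [hN W' hW']

/-- The first `n` steps of a machine depend on the lookups of finitely many URIs. -/
theorem exists_run_congr (W : Web) (x : List Sym) (n : ℕ) :
    ∃ N, ∀ W' : Web, (∀ u : URI, u.id < N → W'.lookup u = W.lookup u) →
      M.run W' x n = M.run W x n := by
  induction n with
  | zero => exact ⟨0, fun _ _ => rfl⟩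
  | succ n ih =>
    obtain ⟨N, hN⟩ := ih
    cases h : M.run W x n with
    | none =>
      refine ⟨N, fun W' hW' => ?_⟩
      simp only [run, hN W' hW', h, Option.bind_none]
    | some c =>
      -- `K` depends on the configuration `c`; this is harmless, because agreement below `N` already
      -- makes the other run reach the same `c`.
      obtain ⟨K, hK⟩ := M.exists_step_congr W c
      refine ⟨max N K, fun W' hW' => ?_⟩
      simp only [run, hN W' fun u hu => hW' u (lt_max_of_lt_left hu), h, Option.bind_some]
      exact hK W' fun u hu => hW' u (lt_max_of_lt_right hu)

/-- A halting computation depends on the lookups of finitely many URIs. -/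
theorem HaltsIn.exists_congr {M : LDMachine} {W : Web} {x : List Sym} {A : Set M.State}
    (h : M.HaltsIn W x A) :
    ∃ N, ∀ W' : Web, (∀ u : URI, u.id < N → W'.lookup u = W.lookup u) →
      M.HaltsIn W' x A := by
  obtain ⟨n, c, hrun, hstep, hA⟩ := h
  obtain ⟨N, hN⟩ := M.exists_run_congr W x n
  obtain ⟨K, hK⟩ := M.exists_step_congr W c
  refine ⟨max N K, fun W' hW' => ⟨n, c, ?_, ?_, hA⟩⟩
  · rw [hN W' fun u hu => hW' u (lt_max_of_lt_left hu), hrun]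
  · rw [hK W' fun u hu => hW' u (lt_max_of_lt_right hu), hstep]

/-- Determinism in usable form: there is only one time at which a run can halt. -/
theorem run_eq_none_of_lt {W : Web} {x : List Sym} {n m : ℕ} {c : M.Config}
    (hrun : M.run W x n = some c) (hstep : M.step W c = none) (h : n < m) :
    M.run W x m = none := by
  induction m, h using Nat.le_induction with
  | base => simp [run, hrun, hstep]
  | succ m _ ih => simp [run, ih]

/-- A machine does not both accept and reject. -/
theorem HaltsIn.not_accepting_and_rejecting {M : LDMachine} {W : Web} {x : List Sym}
    (ha : M.HaltsIn W x M.accepting) (hr : M.HaltsIn W x M.rejecting) : False := by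
  obtain ⟨n, c, hn, hc, hcA⟩ := ha
  obtain ⟨m, d, hm, hd, hdR⟩ := hr
  rcases lt_trichotomy n m with h | rfl | h
  · simp [M.run_eq_none_of_lt hn hc h] at hm
  · obtain rfl : c = d := Option.some.inj (hn.symm.trans hm)
    exact Set.disjoint_left.mp M.disjoint hcA hdR
  · simp [M.run_eq_none_of_lt hm hd h] at hn

end LDMachine

/-- A problem is not decidable if some negative instance cannot be told from positive ones by
finitely many lookups. -/
theorem not_ldMachineDecidable_of_approx {X : Type} {enc : X → List Sym} {𝒲 : Set Web}
    {𝒳 : Set X} {DP : Set (Web × X)} {W : Web} {x : X} (hW : W ∈ 𝒲) (hx : x ∈ 𝒳)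
    (hneg : (W, x) ∉ DP)
    (happrox : ∀ N, ∃ W' ∈ 𝒲, (∀ u : URI, u.id < N → W'.lookup u = W.lookup u) ∧
      (W', x) ∈ DP) :
    ¬ LDMachineDecidable enc 𝒲 𝒳 DP := by
  rintro ⟨M, hM⟩
  -- The bound comes from the rejecting run on `W`; only then is the positive instance `W'` chosen
  -- to fit it.
  obtain ⟨N, hN⟩ := ((hM W hW x hx).2 hneg).exists_congr
  obtain ⟨W', hW', hlookup, hpos⟩ := happrox N
  exact ((hM W' hW' x hx).1 hpos).not_accepting_and_rejecting (hN W' hlookup)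

/-! ### Chains of documents -/

/-- The triple of the `n`-th document of a chain; it mentions the URI of the next document. -/
def chainTriple (n : ℕ) : Triple := ⟨Sum.inl ⟨n⟩, ⟨n⟩, Term.uri ⟨n + 1⟩⟩

theorem chainTriple_bnodes (n : ℕ) : (chainTriple n).bnodes = ∅ := by
  ext b
  simp [Triple.bnodes, Triple.terms, chainTriple, Triple.subject]

/-- The Web whose documents are the members of a chain with index in `s`. -/
noncomputable def chainWeb (s : Set ℕ) : Web where
  D := s
  countable_D := inferInstance
  data n := {chainTriple n}
  bnodes_disjoint d₁ d₂ _ t₁ h₁ t₂ _ := by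
    rw [Finset.mem_singleton.mp h₁, chainTriple_bnodes]
    exact Set.empty_disjoint _
  adoc u := open Classical in if h : u.id ∈ s then some ⟨u.id, h⟩ else none
  adoc_surjective d := ⟨⟨d.1⟩, by simp⟩

theorem chainWeb_adoc {s : Set ℕ} {n : ℕ} (h : n ∈ s) :
    (chainWeb s).adoc ⟨n⟩ = some (⟨n, h⟩ : s) := by
  simp [chainWeb, h]

/-- The last document of a truncated chain still names its successor, so the cut shows only when the
missing URI is looked up. -/
theorem chainWeb_lookup_congr {s t : Set ℕ} {u : URI} (hs : u.id ∈ s) (ht : u.id ∈ t) :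
    (chainWeb s).lookup u = (chainWeb t).lookup u := by
  simp [Web.lookup, chainWeb, hs, ht]

/-- The criterion that accepts every data link. -/
def cAll : ReachCriterion where
  toFun _ _ _ := true
  computable := ⟨fun _ => Part.some true, (Computable.const true).partrec, fun _ _ _ =>
    Part.mem_some true⟩

theorem chainWeb_univ_reachable (P : Expr) (n : ℕ) :
    Reachable (chainWeb Set.univ) {⟨0⟩} cAll P (⟨n, Set.mem_univ n⟩ : (Set.univ : Set ℕ)) := by
  induction n with
  | zero => exact .seed (Finset.mem_singleton_self _) (chainWeb_adoc (Set.mem_univ 0))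
  | succ n ih =>
    refine .link (t := chainTriple n) (u := ⟨n + 1⟩) ih (Finset.mem_singleton_self _) ?_ rfl
      (chainWeb_adoc (Set.mem_univ (n + 1)))
    simp [Triple.uris, Triple.terms, chainTriple]

/-! ### Finite and infinite query results -/

/-- Each variable of the pattern stands at some position, where the triple dictates its value; all
other variables are unbound. -/
theorem TriplePattern.eq_of_instance {tp : TriplePattern} {μ ν : Valuation} {t : Triple}
    (hμ : μ.dom = tp.vars) (hν : ν.dom = tp.vars) (h : tp.Instance μ t) (h' : tp.Instance ν t) :
    μ = ν := by
  funext v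
  by_cases hv : v ∈ tp.vars
  · obtain ⟨hs, hp, ho⟩ := h
    obtain ⟨hs', hp', ho'⟩ := h'
    rcases hv with e | e | e
    · rw [e] at hs hs'
      exact hs.trans hs'.symm
    · rw [e] at hp hp'
      exact hp.trans hp'.symm
    · rw [e] at ho ho'
      exact ho.trans ho'.symm
  · have hμv : v ∉ μ.dom := hμ ▸ hv
    have hνv : v ∉ ν.dom := hν ▸ hv
    simp only [Valuation.dom, Set.mem_ofPred_eq, Bool.not_eq_true, Option.isSome_eq_false_iff,
      Option.isNone_iff_eq_none] at hμv hνv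
    rw [hμv, hνv]

/-- Sort the solutions by the triple they match: each triple admits at most one. -/
theorem finite_eval_tp {G : Set Triple} (hG : G.Finite) (tp : TriplePattern) :
    ((Expr.tp tp).eval G).Finite := by
  have : (⋃ t ∈ G, {μ : Valuation | μ.dom = tp.vars ∧ tp.Instance μ t}).Finite :=
    hG.biUnion fun t _ => Set.Subsingleton.finite fun μ hμ ν hν =>
      TriplePattern.eq_of_instance hμ.1 hν.1 hμ.2 hν.2
  refine this.subset ?_
  rintro μ ⟨hdom, t, ht, hi⟩
  exact Set.mem_biUnion ht ⟨hdom, hi⟩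

theorem Web.IsFinite.finite_allData {W : Web} (h : W.IsFinite) : W.allData.Finite := by
  have : Finite W.D := h
  have he : W.allData = ⋃ d, (W.data d : Set Triple) := by
    ext t
    simp [Web.allData]
  rw [he]
  exact Set.finite_iUnion fun d => (W.data d).finite_toSet

/-- The triple pattern that consists of three distinct variables. -/
def varPattern : TriplePattern := ⟨Sum.inl ⟨0⟩, Sum.inl ⟨1⟩, Sum.inl ⟨2⟩⟩

/-- The valuation that turns `varPattern` into a given triple. -/
def varValuation (t : Triple) : Valuation
  | ⟨0⟩ => some t.subject
  | ⟨1⟩ => some (Term.uri t.p)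
  | ⟨2⟩ => some t.o
  | _ => none

theorem varValuation_mem_eval {G : Set Triple} {t : Triple} (ht : t ∈ G) :
    varValuation t ∈ (Expr.tp varPattern).eval G := by
  refine ⟨?_, t, ht, rfl, rfl, rfl⟩
  ext ⟨n⟩
  match n with
  | 0 | 1 | 2 | n + 3 => simp [Valuation.dom, TriplePattern.vars, varValuation, varPattern]

theorem varValuation_chainTriple_injective :
    Function.Injective fun n => varValuation (chainTriple n) := by
  intro m n h
  -- Variable 1 stands for the predicate, which in `chainTriple n` is the URI of index `n`.
  simpa [varValuation, chainTriple] using congrFun h ⟨1⟩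

/-! ### The two problems on chains -/

/-- The seed of the chain, the criterion that accepts every link, and the pattern that matches
every triple. -/
def chainInput : ReachInput := ⟨{⟨0⟩}, cAll, Expr.tp varPattern⟩

theorem chainInput_mem_admissibleInputs : chainInput ∈ admissibleInputs :=
  -- Since `cAll` is true and `cNone` false everywhere, any argument separates them.
  ⟨Finset.singleton_nonempty _, fun _ _ _ _ => rfl,
    chainTriple 0, ⟨0⟩, Expr.tp varPattern, rfl, rfl⟩

theorem chainWeb_univ_notMem_finitenessReachablePart :
    (chainWeb Set.univ, chainInput) ∉ FinitenessReachablePart := by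
  intro h
  let f (n : ℕ) : (reachablePart (chainWeb Set.univ) {⟨0⟩} cAll (Expr.tp varPattern)).D :=
    ⟨(⟨n, Set.mem_univ n⟩ : (Set.univ : Set ℕ)), chainWeb_univ_reachable _ n⟩
  have hf : Function.Injective f := fun m n e =>
    congrArg Subtype.val (congrArg Subtype.val e)
  have : Finite (reachablePart (chainWeb Set.univ) {⟨0⟩} cAll (Expr.tp varPattern)).D := h
  exact not_finite_iff_infinite.mpr inferInstance (Finite.of_injective f hf)

/-- Each reachable document contributes the solution read off its own triple, and these solutions
are pairwise distinct. -/
theorem chainWeb_univ_notMem_finitenessQueryResult :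
    (chainWeb Set.univ, chainInput) ∉ FinitenessQueryResult :=
  Set.infinite_of_injective_forall_mem varValuation_chainTriple_injective fun n =>
    varValuation_mem_eval
      ⟨⟨(⟨n, Set.mem_univ n⟩ : (Set.univ : Set ℕ)), chainWeb_univ_reachable _ n⟩,
        Finset.mem_singleton_self _⟩

/-- The reachable documents are among those of a finite Web, so reachability need not be computed.
-/
theorem isFinite_reachablePart_chainWeb {s : Set ℕ} (hs : s.Finite) (S : Finset URI)
    (c : ReachCriterion) (P : Expr) : (reachablePart (chainWeb s) S c P).IsFinite := by
  have : Finite (chainWeb s).D := hs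
  exact Subtype.finite

theorem not_ldMachineDecidable_of_chain {enc : ReachInput → List Sym}
    {DP : Set (Web × ReachInput)} (hneg : (chainWeb Set.univ, chainInput) ∉ DP)
    (hpos : ∀ s : Set ℕ, s.Finite → (chainWeb s, chainInput) ∈ DP) :
    ¬ LDMachineDecidable enc Set.univ admissibleInputs DP :=
  not_ldMachineDecidable_of_approx (Set.mem_univ _) chainInput_mem_admissibleInputs hneg fun N =>
    -- The chain cut at exactly the bound: a URI of index below `N` has its document both here and
    -- in the full chain.
    ⟨chainWeb (Set.Iio N), Set.mem_univ _,
      fun _ hu => chainWeb_lookup_congr hu (Set.mem_univ _), hpos _ (Set.finite_Iio N)⟩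

end LinkedData

theorem mainTheorem9 (encC : LinkedData.ReachCriterion → List Bool)
    (hencC : Function.Injective encC) :
    ¬ LinkedData.LDMachineDecidable (LinkedData.ReachInput.enc encC) Set.univ
        LinkedData.admissibleInputs LinkedData.FinitenessReachablePart ∧
    ¬ LinkedData.LDMachineDecidable (LinkedData.ReachInput.enc encC) Set.univ
        LinkedData.admissibleInputs LinkedData.FinitenessQueryResult :=
  ⟨LinkedData.not_ldMachineDecidable_of_chain
      LinkedData.chainWeb_univ_notMem_finitenessReachablePart fun _ hs =>
        LinkedData.isFinite_reachablePart_chainWeb hs _ _ _,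
    LinkedData.not_ldMachineDecidable_of_chain
      LinkedData.chainWeb_univ_notMem_finitenessQueryResult fun _ hs =>
        -- A finite reachable part has finitely many triples, and the query is a single triple
        -- pattern.
        LinkedData.finite_eval_tp
          (LinkedData.isFinite_reachablePart_chainWeb hs _ _ _).finite_allData _⟩
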